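/- For a finite simple graph $G$ and $k\ge 1$, let $R_k(G)$ be the graph whose vertices are the proper $k$-colourings $V(G)\to\{1,\dots,k\}$ of $G$, two colourings being adjacent if they differ on exactly one vertex, and let $d_k(\alpha,\gamma)$ be the length of a shortest path in $R_k(G)$ from $\alpha$ to $\gamma$ (infinite if there is none). A $k$-colouring $\gamma$ is frozen if, for every vertex $v$, every colour except $\gamma(v)$ is used on the neighbours of $v$. For $l\le k$, an $l$-colouring is regarded as a $k$-colouring that uses only the colours $1,\dots,l$. Theorem. There is an absolute constant $C$ such that the following holds. Let $G$ be a connected graph on $n$ vertices with maximum degree $\Delta\ge 1$, let $k\ge\Delta+1$, and let $\alpha$ be a $k$-colouring of $G$ that is not frozen. Suppose that $G$ is not the complete graph $K_{\Delta+1}$, that $G$ is not a cycle with an odd number of vertices, and that, if $k=3$, $G$ is not a cycle on $8$ or more vertices. Then there is a $\Delta$-colouring $\gamma$ of $G$ with $d_k(\alpha,\gamma)\le C n^2$. -/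

import Mathlib

/-- The `k`-colouring reconfiguration graph `R_k(G)`: its vertices are the proper colourings of `G`
with colours in `Fin k`, and two colourings are adjacent if they disagree on exactly one vertex. -/
def reconfGraph {V : Type*} (G : SimpleGraph V) (k : ℕ) : SimpleGraph (G.Coloring (Fin k)) where
  Adj γ₁ γ₂ := ∃ u : V, γ₁ u ≠ γ₂ u ∧ ∀ v : V, v ≠ u → γ₁ v = γ₂ v
  symm := ⟨fun _ _ ⟨u, hu, h⟩ => ⟨u, hu.symm, fun v hv => (h v hv).symm⟩⟩
  loopless := ⟨fun _ ⟨_, hu, _⟩ => hu rfl⟩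

/-- A `k`-colouring is frozen if, for every vertex `v`, every colour except that of `v` is used on
some neighbour of `v`. -/
def IsFrozen {V : Type*} {G : SimpleGraph V} {k : ℕ} (γ : G.Coloring (Fin k)) : Prop :=
  ∀ v : V, ∀ c : Fin k, c ≠ γ v → ∃ w : V, G.Adj v w ∧ γ w = c

/-- An `l`-colouring, regarded as a `k`-colouring (`l ≤ k`) that uses only the first `l` colours. -/
def widenColoring {V : Type*} {G : SimpleGraph V} {l k : ℕ} (h : l ≤ k)
    (γ : G.Coloring (Fin l)) : G.Coloring (Fin k) :=
  SimpleGraph.Coloring.mk (fun v => Fin.castLE h (γ v)) fun {_ _} hvw e =>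
    γ.valid hvw (Fin.castLE_injective h e)

/-!
Throughout, a vertex is free if it can be recoloured at once. It suffices to reach, in `O(n ^ 2)`
recolourings, a `(Δ + 1)`-colouring in which some colour `q` is not used: the last colour can then be
replaced by `q` (`exists_merge`).

A vertex of degree at most `Δ` that is not free sees each other colour exactly once. So if `p₀ p₁ … pₘ`
is a shortest path from `p₀` to the set of free vertices, one can recolour `pₘ`, then give `pₘ₋₁` the
old colour of `pₘ`, and so on down to `p₀`. Suppose that there are vertices that stay free throughout,
because their degree is less than `Δ` or because two of their neighbours have equal colours that are
kept fixed. Applying such shifts to a vertex of colour `q` nearest to them removes this vertex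
from the class of `q` or moves it towards them, at a cost proportional to the distance gained
(`exists_shift`, `exists_reachIn_of_slack`). This settles the graphs that are not regular
(`exists_reachIn_of_degree_lt`).

In a `Δ`-regular graph a colouring that is not frozen has a free vertex, and freeness can be moved along
any path to any vertex `v` (`exists_isFree_of_walk`). Then two neighbours `a`, `b` of `v` have the same
colour, but there is no control over which two. For `Δ ≥ 3` there is a vertex `v` for which every pair
will do (`exists_isSuitable`): after `a` and `b` are deleted, each component contains a common neighbour
of `a` and `b`, which stays free while the colours of `a` and `b` are kept. It is found opposite a
largest component left by a separating pair. For `Δ = 2` the graph is a cycle, and only those on 4 and 6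
vertices remain to be considered when there are three colours.

With `Δ + 2` or more colours every vertex is always free, any two colourings are joined by a short path
(`exists_reachIn_of_degree_add_two_le`), and only the existence of a `Δ`-colouring is needed. This is
Brooks' theorem, which follows from the case of `Δ + 1` colours
(`nonempty_coloring_of_degree_le`).
-/

/-! ### Recolouring sequences of bounded length -/

/-- `ReachIn m α β`: the colouring `β` can be reached from `α` by at most `m` recolourings of
single vertices. -/
def ReachIn {V : Type*} {G : SimpleGraph V} {k : ℕ} (m : ℕ) (α β : G.Coloring (Fin k)) : Prop :=
  ∃ w : (reconfGraph G k).Walk α β, w.length ≤ m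

/-- `IsFree α v`: the vertex `v` can be given another colour while all other vertices keep theirs.
A colouring is frozen exactly when it has no free vertex. -/
def IsFree {V : Type*} {G : SimpleGraph V} {k : ℕ} (α : G.Coloring (Fin k)) (v : V) : Prop :=
  ∃ c, c ≠ α v ∧ ∀ w, G.Adj v w → α w ≠ c

section Recolouring

variable {V : Type*} {G : SimpleGraph V} {k : ℕ}

lemma ReachIn.refl (α : G.Coloring (Fin k)) (m : ℕ) : ReachIn m α α := ⟨.nil, by simp⟩

lemma ReachIn.trans {m₁ m₂ : ℕ} {α β γ : G.Coloring (Fin k)} (h₁ : ReachIn m₁ α β)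
    (h₂ : ReachIn m₂ β γ) : ReachIn (m₁ + m₂) α γ := by
  obtain ⟨w₁, h₁⟩ := h₁
  obtain ⟨w₂, h₂⟩ := h₂
  exact ⟨w₁.append w₂, by rw [SimpleGraph.Walk.length_append]; omega⟩

lemma ReachIn.mono {m₁ m₂ : ℕ} {α β : G.Coloring (Fin k)} (h : ReachIn m₁ α β) (hm : m₁ ≤ m₂) :
    ReachIn m₂ α β :=
  h.imp fun _ h => h.trans hm

lemma exists_isFree_of_not_isFrozen {α : G.Coloring (Fin k)} (h : ¬ IsFrozen α) :
    ∃ v, IsFree α v := by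
  unfold IsFrozen at h
  push Not at h
  obtain ⟨v, c, hc, h⟩ := h
  exact ⟨v, c, hc, h⟩

lemma exists_recolor (α : G.Coloring (Fin k)) {v : V} {c : Fin k}
    (h : ∀ w, G.Adj v w → α w ≠ c) :
    ∃ β : G.Coloring (Fin k), ReachIn 1 α β ∧ β v = c ∧ ∀ u, u ≠ v → β u = α u := by
  classical
  by_cases hc : α v = c
  · exact ⟨α, .refl _ _, hc, fun _ _ => rfl⟩
  let β : G.Coloring (Fin k) := SimpleGraph.Coloring.mk (Function.update α v c) (by
    intro x y hxy
    by_cases hx : x = v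
    · subst hx
      have hy : y ≠ x := hxy.ne'
      simpa [hy] using (h y hxy).symm
    · by_cases hy : y = v
      · subst hy
        simpa [hx] using h x hxy.symm
      · simpa [hx, hy] using α.valid hxy)
  have hv : β v = c := by simp [β, SimpleGraph.Coloring.mk]
  have hu : ∀ u, u ≠ v → β u = α u := fun u hu => by
    simp [β, SimpleGraph.Coloring.mk, hu]
  refine ⟨β, ?_, hv, hu⟩
  have hadj : (reconfGraph G k).Adj α β := ⟨v, by rwa [hv], fun u h => (hu u h).symm⟩
  exact ⟨hadj.toWalk, by simp⟩

variable [Fintype V] [DecidableRel G.Adj]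

/-- With more than `deg v` colours, a vertex that is not free sees each other colour exactly
once. -/
lemma ne_of_not_isFree {α : G.Coloring (Fin k)} {v a b : V} (hdeg : G.degree v + 1 ≤ k)
    (hv : ¬ IsFree α v) (ha : G.Adj v a) (hb : G.Adj v b) (hab : a ≠ b) : α a ≠ α b := by
  classical
  intro he
  apply hv
  -- two neighbours share a colour, so fewer than `k - 1` colours are seen
  have h1 : ((G.neighborFinset v).erase a).card + 1 = G.degree v := by
    rw [Finset.card_erase_add_one (by simpa using ha), SimpleGraph.card_neighborFinset_eq_degree]
  have h2 := Finset.card_image_le (s := (G.neighborFinset v).erase a) (f := α)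
  have h3 := Finset.card_insert_le (α v) (((G.neighborFinset v).erase a).image α)
  obtain ⟨c, hc⟩ : ∃ c, c ∉ insert (α v) (((G.neighborFinset v).erase a).image α) := by
    by_contra! hall
    have := Finset.card_le_card (fun c _ => hall c : (Finset.univ : Finset (Fin k)) ⊆ _)
    rw [Finset.card_univ, Fintype.card_fin] at this
    omega
  simp only [Finset.mem_insert, Finset.mem_image, Finset.mem_erase,
    SimpleGraph.mem_neighborFinset, not_or, not_exists, not_and, and_imp] at hc
  refine ⟨c, hc.1, fun w hw => ?_⟩
  by_cases hwa : w = a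
  · subst hwa
    rw [he]
    exact hc.2 b hab.symm hb
  · exact hc.2 w hwa hw

lemma isFree_of_degree_add_two_le {α : G.Coloring (Fin k)} {v : V}
    (hdeg : G.degree v + 2 ≤ k) : IsFree α v := by
  classical
  have h2 := Finset.card_image_le (s := G.neighborFinset v) (f := α)
  have h3 := Finset.card_insert_le (α v) ((G.neighborFinset v).image α)
  rw [SimpleGraph.card_neighborFinset_eq_degree] at h2
  obtain ⟨c, hc⟩ : ∃ c, c ∉ insert (α v) ((G.neighborFinset v).image α) := by
    by_contra! hall
    have := Finset.card_le_card (fun c _ => hall c : (Finset.univ : Finset (Fin k)) ⊆ _)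
    rw [Finset.card_univ, Fintype.card_fin] at this
    omega
  simp only [Finset.mem_insert, Finset.mem_image,
    SimpleGraph.mem_neighborFinset, not_or, not_exists, not_and] at hc
  exact ⟨c, hc.1, hc.2⟩

/-- A free vertex of degree at least `k - 1` has two neighbours of the same colour. -/
lemma exists_eq_of_isFree {α : G.Coloring (Fin k)} {v : V} (hdeg : k ≤ G.degree v + 1)
    (hv : IsFree α v) : ∃ a b, G.Adj v a ∧ G.Adj v b ∧ a ≠ b ∧ α a = α b := by
  classical
  obtain ⟨c, hc, h⟩ := hv
  have hcard : ((Finset.univ.erase c).erase (α v)).card < (G.neighborFinset v).card := by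
    have h1 := Finset.card_erase_add_one (Finset.mem_univ c)
    have h2 := Finset.card_erase_add_one
      (Finset.mem_erase.2 ⟨hc.symm, Finset.mem_univ (α v)⟩)
    rw [Finset.card_univ, Fintype.card_fin] at h1
    rw [SimpleGraph.card_neighborFinset_eq_degree]
    omega
  obtain ⟨a, ha, b, hb, hab, he⟩ := Finset.exists_ne_map_eq_of_card_lt_of_maps_to hcard
    (f := α) (fun w hw => by
      rw [SimpleGraph.coe_neighborFinset, SimpleGraph.mem_neighborSet] at hw
      simpa using ⟨h w hw, (α.valid hw).symm⟩)
  exact ⟨a, b, by simpa using ha, by simpa using hb, hab, he⟩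

/-- Freeness travels: if the far end of a walk is free, then its start becomes free after at most
as many recolourings as the walk has edges. -/
lemma exists_isFree_of_walk (hdeg : ∀ v, G.degree v + 1 ≤ k) {v f : V} (p : G.Walk v f)
    {α : G.Coloring (Fin k)} (hf : IsFree α f) :
    ∃ β, ReachIn p.length α β ∧ IsFree β v := by
  induction p with
  | nil => exact ⟨α, .refl _ _, hf⟩
  | @cons v x f hvx p ih =>
    obtain ⟨β, hβ, hx⟩ := ih hf
    by_cases hv : IsFree β v
    · exact ⟨β, hβ.mono (by simp), hv⟩
    obtain ⟨c, hc, h⟩ := hx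
    obtain ⟨β', hβ', h1, h2⟩ := exists_recolor β h
    refine ⟨β', hβ.trans hβ', β x, ?_, fun w hw => ?_⟩
    · rw [h2 v hvx.ne]
      exact (β.valid hvx).symm
    · by_cases hwx : w = x
      · subst hwx
        rwa [h1]
      · rw [h2 w hwx]
        exact ne_of_not_isFree (hdeg v) hv hw hvx hwx

/-! ### Removing a colour -/

/-- Shifting colours towards free vertices. Let `h` measure the distance to a set of vertices that
are free in every colouring extending the colours of `α` on the fixed set `F`. A vertex `p` at
level `d`, with the colour `q` absent from all lower levels, can be recoloured by changes at `p`
and below only; this creates at most one vertex `w` of colour `q` there, and `w` lies at least `m`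
levels below `p` if `m + 1` recolourings were used. -/
lemma exists_shift (hdeg : ∀ v, G.degree v + 1 ≤ k) {F : Set V} {h : V → ℕ} {q : Fin k}
    (hadj : ∀ u w, u ∉ F → w ∉ F → G.Adj u w → h u ≤ h w + 1)
    (hpar : ∀ v, v ∉ F → h v ≠ 0 → ∃ p, p ∉ F ∧ G.Adj v p ∧ h p + 1 = h v)
    {α : G.Coloring (Fin k)}
    (hfree : ∀ v, v ∉ F → h v = 0 → ∀ β : G.Coloring (Fin k), (∀ u ∈ F, β u = α u) → IsFree β v)
    (d : ℕ) : ∀ p, p ∉ F → h p = d → ∀ β : G.Coloring (Fin k), (∀ u ∈ F, β u = α u) →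
      (∀ u, u ∉ F → h u < d → β u ≠ q) →
      ∃ (β' : G.Coloring (Fin k)) (m : ℕ) (w : V), ReachIn (m + 1) β β' ∧
        (∀ u ∈ F, β' u = α u) ∧ β' p ≠ β p ∧
        (∀ u, u ∉ F → d ≤ h u → u ≠ p → β' u = β u) ∧
        w ∉ F ∧ h w + m ≤ d ∧ ∀ u, u ∉ F → (h u < d ∨ u = p) → β' u = q → u = w := by
  induction d with
  | zero =>
    intro p hp hd β hF hq
    obtain ⟨c, hc, h'⟩ := hfree p hp hd β hF
    obtain ⟨β', h1, h2, h3⟩ := exists_recolor β h'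
    refine ⟨β', 0, p, h1, fun u hu => ?_, by rwa [h2], fun u _ _ hu => h3 u hu, hp, by omega,
      fun u hu hu' => ?_⟩
    · rw [h3 u (fun e => hp (e ▸ hu)), hF u hu]
    · simp only [Nat.not_lt_zero, false_or] at hu'
      exact fun _ => hu'
  | succ d ih =>
    intro p hp hd β hF hq
    by_cases hfp : IsFree β p
    · obtain ⟨c, hc, h'⟩ := hfp
      obtain ⟨β', h1, h2, h3⟩ := exists_recolor β h'
      refine ⟨β', 0, p, h1, fun u hu => ?_, by rwa [h2], fun u _ _ hu => h3 u hu, hp, by omega,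
        fun u hu hu' hq' => ?_⟩
      · rw [h3 u (fun e => hp (e ▸ hu)), hF u hu]
      · by_contra hup
        rw [h3 u hup] at hq'
        exact hq u hu (hu'.resolve_right hup) hq'
    obtain ⟨x, hx, hpx, hlev⟩ := hpar p hp (by omega)
    obtain ⟨β₁, m, w, r1, r2, r3, r4, r5, r6, r7⟩ :=
      ih x hx (by omega) β hF (fun u hu hlt => hq u hu (by omega))
    -- among the neighbours of `p` only `x` has changed, and `p` is locked in `β`
    have hcol : ∀ y, G.Adj p y → β₁ y ≠ β x := by
      intro y hy
      by_cases hyx : y = x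
      · rwa [hyx]
      have : β₁ y = β y := by
        by_cases hyF : y ∈ F
        · rw [r2 y hyF, hF y hyF]
        · exact r4 y hyF (by have := hadj p y hp hyF hy; omega) hyx
      rw [this]
      exact ne_of_not_isFree (hdeg p) hfp hy hpx hyx
    obtain ⟨β₂, s1, s2, s3⟩ := exists_recolor β₁ hcol
    refine ⟨β₂, m + 1, w, r1.trans s1, fun u hu => ?_, ?_, fun u hu hlt hup => ?_, r5, by omega,
      fun u hu hu' hq' => ?_⟩
    · rw [s3 u (fun e => hp (e ▸ hu)), r2 u hu]
    · rw [s2]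
      exact (β.valid hpx).symm
    · rw [s3 u hup]
      exact r4 u hu (by omega) (fun e => by subst e; omega)
    · by_cases hup : u = p
      · subst hup
        rw [s2] at hq'
        exact absurd hq' (hq x hx (by omega))
      · rw [s3 u hup] at hq'
        have hlt := hu'.resolve_right hup
        by_cases hux : u = x
        · exact r7 u hu (.inr hux) hq'
        by_cases hu2 : h u < d
        · exact r7 u hu (.inl hu2) hq'
        · rw [r4 u hu (by omega) hux] at hq'
          exact absurd hq' (hq u hu hlt)

/-- The sum of the levels, counted from one, of the vertices of colour `q` drops, at each shift of a lowest such
vertex, by at least half the number of recolourings used. -/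
lemma exists_reachIn_forall_ne (hdeg : ∀ v, G.degree v + 1 ≤ k) {F : Set V} {h : V → ℕ} {q : Fin k}
    (hadj : ∀ u w, u ∉ F → w ∉ F → G.Adj u w → h u ≤ h w + 1)
    (hpar : ∀ v, v ∉ F → h v ≠ 0 → ∃ p, p ∉ F ∧ G.Adj v p ∧ h p + 1 = h v)
    {α : G.Coloring (Fin k)} (hαq : ∀ u ∈ F, α u ≠ q)
    (hfree : ∀ v, v ∉ F → h v = 0 → ∀ β : G.Coloring (Fin k), (∀ u ∈ F, β u = α u) → IsFree β v)
    (N : ℕ) : ∀ β : G.Coloring (Fin k), (∀ u ∈ F, β u = α u) →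
      ∑ u with β u = q, (h u + 1) ≤ N → ∃ β', ReachIn (2 * N) β β' ∧ ∀ u, β' u ≠ q := by
  classical
  induction N using Nat.strong_induction_on with
  | _ N ih =>
    intro β hF hN
    by_cases hex : ∃ v, β v = q
    swap
    · push Not at hex
      exact ⟨β, .refl _ _, hex⟩
    obtain ⟨v, hv, hmin⟩ := Finset.exists_min_image (Finset.univ.filter fun v => β v = q) h
      (by obtain ⟨v, hv⟩ := hex; exact ⟨v, by simpa using hv⟩)
    simp only [Finset.mem_filter, Finset.mem_univ, true_and] at hv hmin
    have hvF : v ∉ F := fun hvF => hαq v hvF (by rw [← hF v hvF, hv])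
    obtain ⟨β', m, w, r1, r2, r3, r4, r5, r6, r7⟩ := exists_shift hdeg hadj hpar hfree (h v) v hvF
      rfl β hF (fun u _ hlt hu => absurd (hmin u hu) (by omega))
    rw [hv] at r3
    have hsum : ∑ u ∈ (Finset.univ.filter fun u => β u = q).erase v, (h u + 1) + (h v + 1)
        = ∑ u with β u = q, (h u + 1) := Finset.sum_erase_add _ _ (by simpa using hv)
    have hold : ∀ u, β' u = q → u ≠ w ∨ h v ≤ h u →
        u ∈ (Finset.univ.filter fun u => β u = q).erase v := by
      intro u hu huw
      have huF : u ∉ F := fun huF => hαq u huF (by rw [← r2 u huF, hu])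
      have huv : u ≠ v := fun e => r3 (e ▸ hu)
      simp only [Finset.mem_erase, Finset.mem_filter, Finset.mem_univ, true_and]
      refine ⟨huv, ?_⟩
      have hlev : h v ≤ h u := by
        rcases huw with huw | huw
        · by_contra hlt
          exact huw (r7 u huF (.inl (by omega)) hu)
        · exact huw
      rw [← r4 u huF hlev huv, hu]
    -- the shift cost at most `m + 1`, which is at most twice the drop of the sum from `N`
    have hdrop : ∑ u with β' u = q, (h u + 1) + (m + 1) ≤ 2 * N - ∑ u with β' u = q, (h u + 1) ∧
        ∑ u with β' u = q, (h u + 1) < N := by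
      by_cases hw : h w < h v
      · have hsub : (Finset.univ.filter fun u => β' u = q) ⊆
            insert w ((Finset.univ.filter fun u => β u = q).erase v) := by
          intro u hu
          rw [Finset.mem_insert]
          by_cases huw : u = w
          · exact .inl huw
          · exact .inr (hold u (by simpa using hu) (.inl huw))
        have h1 := Finset.sum_le_sum_of_subset (f := fun u => h u + 1) hsub
        have h2 : ∑ u ∈ insert w ((Finset.univ.filter fun u => β u = q).erase v), (h u + 1) ≤
            (h w + 1) + ∑ u ∈ (Finset.univ.filter fun u => β u = q).erase v, (h u + 1) := by
          rw [Finset.insert_eq]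
          exact (Finset.sum_union_inter (f := fun u => h u + 1) ▸ Nat.le_add_right _ _).trans
            (by simp)
        omega
      · have hsub : (Finset.univ.filter fun u => β' u = q) ⊆
            (Finset.univ.filter fun u => β u = q).erase v := by
          intro u hu
          refine hold u (by simpa using hu) ?_
          by_cases huw : u = w
          · exact .inr (by rw [huw]; omega)
          · exact .inl huw
        have h1 := Finset.sum_le_sum_of_subset (f := fun u => h u + 1) hsub
        omega
    obtain ⟨β'', s1, s2⟩ := ih _ hdrop.2 β' r2 le_rfl
    exact ⟨β'', (r1.trans s1).mono (by omega), s2⟩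

end Recolouring

/-! ### Fixing the colours of some vertices -/

/-- The graph `G` with all edges at vertices of `S` removed. Its walks from a vertex outside `S`
are the walks of `G - S`. -/
def avoid {V : Type*} (G : SimpleGraph V) (S : Set V) : SimpleGraph V where
  Adj u w := G.Adj u w ∧ u ∉ S ∧ w ∉ S
  symm := ⟨fun _ _ ⟨h, hu, hw⟩ => ⟨h.symm, hw, hu⟩⟩
  loopless := ⟨fun _ ⟨h, _⟩ => h.ne rfl⟩

section Removal

variable {V : Type*} {G : SimpleGraph V} {k : ℕ} [Fintype V]

/-- The colour class of `r` can be recoloured with an unused colour `q` vertex by vertex. -/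
lemma exists_merge {α : G.Coloring (Fin k)} {q r : Fin k} (hq : ∀ u, α u ≠ q) (hqr : q ≠ r) :
    ∃ β, ReachIn (Fintype.card V) α β ∧ ∀ u, β u ≠ r := by
  classical
  suffices H : ∀ S : Finset V, ∃ β : G.Coloring (Fin k), ReachIn S.card α β ∧
      ∀ u, β u = if u ∈ S ∧ α u = r then q else α u by
    obtain ⟨β, h1, h2⟩ := H Finset.univ
    refine ⟨β, h1, fun u => ?_⟩
    rw [h2]
    split_ifs with h
    · exact hqr
    · simpa using h
  intro S
  induction S using Finset.induction_on with
  | empty => exact ⟨α, .refl _ _, by simp⟩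
  | insert v S hv ih =>
    obtain ⟨β, h1, h2⟩ := ih
    rw [Finset.card_insert_of_notMem hv]
    by_cases hvr : α v = r
    · obtain ⟨β', s1, s2, s3⟩ := exists_recolor β (v := v) (c := q) (fun w hw => by
        have : α w ≠ r := fun h => α.valid hw (hvr.trans h.symm)
        rw [h2, if_neg (fun h => this h.2)]
        exact hq w)
      refine ⟨β', h1.trans s1, fun u => ?_⟩
      by_cases huv : u = v
      · subst huv
        simp [s2, hvr]
      · rw [s3 u huv, h2]
        simp [huv]
    · refine ⟨β, h1.mono (by omega), fun u => ?_⟩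
      rw [h2]
      by_cases huv : u = v
      · subst huv
        simp [hvr]
      · simp [huv]

/-- Which colour is missing is immaterial: it can be exchanged for the last one. -/
lemma exists_widen_of_forall_ne {Δ : ℕ} {α β : G.Coloring (Fin (Δ + 1))} {m : ℕ}
    (hαβ : ReachIn m α β) {q : Fin (Δ + 1)} (hq : ∀ u, β u ≠ q) :
    ∃ γ : G.Coloring (Fin Δ),
      ReachIn (m + Fintype.card V) α (widenColoring (Nat.le_succ Δ) γ) := by
  obtain ⟨β', h1, h2⟩ : ∃ β', ReachIn (m + Fintype.card V) α β' ∧ ∀ u, β' u ≠ Fin.last Δ := by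
    by_cases hql : q = Fin.last Δ
    · exact ⟨β, hαβ.mono (by omega), fun u => hql ▸ hq u⟩
    · obtain ⟨β', h1, h2⟩ := exists_merge hq hql
      exact ⟨β', hαβ.trans h1, h2⟩
  let γ : G.Coloring (Fin Δ) := SimpleGraph.Coloring.mk (fun v => (β' v).castPred (h2 v))
    (fun {v w} hvw h => β'.valid hvw (Fin.castPred_inj.1 h))
  have : widenColoring (Nat.le_succ Δ) γ = β' := by
    ext v
    rfl
  exact ⟨γ, this ▸ h1⟩

variable [DecidableRel G.Adj]

/-- If every vertex outside `F` is joined in `G - F` to a vertex of `Z`, and the vertices of `Z` are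
free as long as the colours on `F` are kept, then any colour not used on `F` can be removed. -/
lemma exists_reachIn_of_slack (hdeg : ∀ v, G.degree v + 1 ≤ k) {F Z : Set V} {q : Fin k}
    {α : G.Coloring (Fin k)} (hαq : ∀ u ∈ F, α u ≠ q)
    (hreach : ∀ v, v ∉ F → ∃ z ∈ Z, (avoid G F).Reachable v z)
    (hfree : ∀ z ∈ Z, z ∉ F → ∀ β : G.Coloring (Fin k), (∀ u ∈ F, β u = α u) → IsFree β z) :
    ∃ β, ReachIn (2 * Fintype.card V ^ 2) α β ∧ ∀ u, β u ≠ q := by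
  classical
  -- the level of `v` is its distance to `Z` in `G - F`
  let L : V → Set ℕ := fun v => {m | ∃ z ∈ Z, ∃ p : (avoid G F).Walk v z, p.length = m}
  let h : V → ℕ := fun v => sInf (L v)
  have hne : ∀ v, v ∉ F → (L v).Nonempty := fun v hv => by
    obtain ⟨z, hz, ⟨p⟩⟩ := hreach v hv
    exact ⟨p.length, z, hz, p, rfl⟩
  have hlt : ∀ v, v ∉ F → h v + 1 ≤ Fintype.card V := fun v hv => by
    obtain ⟨z, hz, ⟨p⟩⟩ := hreach v hv
    have h1 : h v ≤ p.bypass.length := Nat.sInf_le ⟨z, hz, p.bypass, rfl⟩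
    have h2 := p.bypass_isPath.length_lt
    omega
  have hadj : ∀ u w, u ∉ F → w ∉ F → G.Adj u w → h u ≤ h w + 1 := fun u w hu hw huw => by
    obtain ⟨z, hz, p, hp⟩ := Nat.sInf_mem (hne w hw)
    have huw' : (avoid G F).Adj u w := ⟨huw, hu, hw⟩
    exact Nat.sInf_le ⟨z, hz, .cons huw' p, by rw [SimpleGraph.Walk.length_cons, hp]⟩
  have hpar : ∀ v, v ∉ F → h v ≠ 0 → ∃ p, p ∉ F ∧ G.Adj v p ∧ h p + 1 = h v := by
    intro v hv h0
    obtain ⟨z, hz, p, hp⟩ := Nat.sInf_mem (hne v hv)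
    change p.length = h v at hp
    cases p with
    | nil => exact absurd hp.symm h0
    | @cons _ x _ hvx p =>
      refine ⟨x, hvx.2.2, hvx.1, ?_⟩
      have h1 : h x ≤ p.length := Nat.sInf_le ⟨z, hz, p, rfl⟩
      have h2 := hadj v x hv hvx.2.2 hvx.1
      rw [SimpleGraph.Walk.length_cons] at hp
      omega
  have hzero : ∀ v, v ∉ F → h v = 0 → v ∈ Z := by
    intro v hv h0
    obtain ⟨z, hz, p, hp⟩ := Nat.sInf_mem (hne v hv)
    change p.length = h v at hp
    rw [SimpleGraph.Walk.eq_of_length_eq_zero (hp.trans h0)]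
    exact hz
  refine (exists_reachIn_forall_ne hdeg hadj hpar hαq
    (fun v hv h0 => hfree v (hzero v hv h0) hv) (Fintype.card V ^ 2) α (fun _ _ => rfl) ?_)
  calc ∑ u with α u = q, (h u + 1) ≤ ∑ u with α u = q, Fintype.card V :=
        Finset.sum_le_sum fun u hu => hlt u fun huF => hαq u huF (by simpa using hu)
    _ ≤ Fintype.card V ^ 2 := by
        rw [Finset.sum_const, smul_eq_mul, sq]
        exact Nat.mul_le_mul_right _ (Finset.card_le_univ _)

/-- A vertex with two neighbours in a monochromatic fixed set is free whatever the other colours. -/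
lemma exists_reachIn_of_monochromatic (hk : 2 ≤ k) (hdeg : ∀ v, G.degree v + 1 ≤ k) {F : Set V}
    {α : G.Coloring (Fin k)} (hmono : ∀ u ∈ F, ∀ w ∈ F, α u = α w)
    (hreach : ∀ v, v ∉ F → ∃ z, (∃ a ∈ F, ∃ b ∈ F, a ≠ b ∧ G.Adj z a ∧ G.Adj z b) ∧
      (avoid G F).Reachable v z) :
    ∃ (q : Fin k) (β : _), ReachIn (2 * Fintype.card V ^ 2) α β ∧ ∀ u, β u ≠ q := by
  obtain ⟨q, hq⟩ : ∃ q : Fin k, ∀ u ∈ F, α u ≠ q := by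
    rcases F.eq_empty_or_nonempty with rfl | ⟨a, ha⟩
    · exact ⟨⟨0, by omega⟩, by simp⟩
    · have : Nontrivial (Fin k) := Fin.nontrivial_iff_two_le.2 hk
      obtain ⟨q, hq⟩ := exists_ne (α a)
      exact ⟨q, fun u hu => by rw [hmono u hu a ha]; exact hq.symm⟩
  refine ⟨q, exists_reachIn_of_slack hdeg hq
    (Z := {z | ∃ a ∈ F, ∃ b ∈ F, a ≠ b ∧ G.Adj z a ∧ G.Adj z b}) hreach ?_⟩
  rintro z ⟨a, ha, b, hb, hab, hza, hzb⟩ - β hβ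
  by_contra hz
  exact ne_of_not_isFree (hdeg z) hz hza hzb hab (by rw [hβ a ha, hβ b hb, hmono a ha b hb])

lemma exists_reachIn_of_degree_lt (hG : G.Connected) (hdeg : ∀ v, G.degree v + 1 ≤ k) {x : V}
    (hx : G.degree x + 2 ≤ k) (α : G.Coloring (Fin k)) (q : Fin k) :
    ∃ β, ReachIn (2 * Fintype.card V ^ 2) α β ∧ ∀ u, β u ≠ q := by
  have h : avoid G ∅ = G := by ext; simp [avoid]
  refine exists_reachIn_of_slack hdeg (F := ∅) (Z := {x}) (by simp)
    (fun v _ => ⟨x, rfl, by rw [h]; exact hG.preconnected v x⟩) ?_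
  rintro z rfl - β -
  exact isFree_of_degree_add_two_le hx

/-! ### Two more colours than the maximum degree -/

/-- With at least `Δ + 2` colours any colouring `γ` can be approached one vertex `v` at a time: the
neighbours of `v` that have the colour `γ v` are free, so they can be moved away from it. -/
lemma exists_reachIn_of_degree_add_two_le {Δ : ℕ} (hΔ : ∀ v, G.degree v ≤ Δ) (hk : Δ + 2 ≤ k)
    (α γ : G.Coloring (Fin k)) : ReachIn (Fintype.card V * (Δ + 1)) α γ := by
  classical
  suffices H : ∀ S : Finset V, ∃ β : G.Coloring (Fin k), ReachIn (S.card * (Δ + 1)) α β ∧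
      ∀ u ∈ S, β u = γ u by
    obtain ⟨β, h1, h2⟩ := H Finset.univ
    have : β = γ := by
      ext u
      rw [h2 u (Finset.mem_univ u)]
    exact this ▸ h1
  intro S
  induction S using Finset.induction_on with
  | empty => exact ⟨α, .refl _ _, by simp⟩
  | insert v S hv ih =>
    obtain ⟨β, h1, h2⟩ := ih
    have clear : ∀ T : Finset V, T ⊆ G.neighborFinset v → ∃ β' : G.Coloring (Fin k),
        ReachIn T.card β β' ∧ (∀ u ∈ S, β' u = γ u) ∧ ∀ u ∈ T, β' u ≠ γ v := by
      intro T
      induction T using Finset.induction_on with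
      | empty => exact fun _ => ⟨β, .refl _ _, h2, by simp⟩
      | insert x T hx ih =>
        intro hT
        obtain ⟨β', s1, s2, s3⟩ := ih fun u hu => hT (Finset.mem_insert_of_mem hu)
        rw [Finset.card_insert_of_notMem hx]
        have hvx : G.Adj v x := by simpa using hT (Finset.mem_insert_self x T)
        by_cases hxc : β' x = γ v
        · have hxS : x ∉ S := fun hxS => γ.valid hvx (by rw [← s2 x hxS, hxc])
          obtain ⟨c, hc, hfree⟩ := isFree_of_degree_add_two_le (α := β') (v := x)
            (by have := hΔ x; omega)
          obtain ⟨β'', t1, t2, t3⟩ := exists_recolor β' hfree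
          refine ⟨β'', s1.trans t1, fun u hu => ?_, fun u hu => ?_⟩
          · rw [t3 u (fun e => hxS (e ▸ hu)), s2 u hu]
          · by_cases hux : u = x
            · rw [hux, t2, ← hxc]
              exact hc
            · rw [t3 u hux]
              exact s3 u (Finset.mem_of_mem_insert_of_ne hu hux)
        · refine ⟨β', s1.mono (by omega), s2, fun u hu => ?_⟩
          rcases Finset.mem_insert.1 hu with rfl | hu
          · exact hxc
          · exact s3 u hu
    obtain ⟨β', s1, s2, s3⟩ := clear _ subset_rfl
    obtain ⟨β'', t1, t2, t3⟩ := exists_recolor β' (v := v) (c := γ v)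
      (fun w hw => s3 w (by simpa using hw))
    refine ⟨β'', ((h1.trans s1).trans t1).mono ?_, fun u hu => ?_⟩
    · rw [Finset.card_insert_of_notMem hv, SimpleGraph.card_neighborFinset_eq_degree]
      have := hΔ v
      rw [Nat.succ_mul]
      omega
    · rcases Finset.mem_insert.1 hu with rfl | hu
      · exact t2
      · rw [t3 u (fun e => hv (e ▸ hu)), s2 u hu]

end Removal

/-! ### Separating pairs in regular graphs -/

section Separation

variable {V : Type*} {G : SimpleGraph V}

/-- Deleting `S` leaves a connected (or empty) graph. -/
def ConnectedAvoiding (G : SimpleGraph V) (S : Set V) : Prop :=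
  ∀ u, u ∉ S → ∀ w, w ∉ S → (avoid G S).Reachable u w

/-- The vertex set of the component of `G - S` that contains `m`. -/
def compAvoiding (G : SimpleGraph V) (S : Set V) (m : V) : Set V :=
  {u | (avoid G S).Reachable m u}

/-- Whenever two nonadjacent neighbours `a`, `b` of `v` are deleted, each of the remaining components
contains a common neighbour of `a` and `b`. -/
def IsSuitable (G : SimpleGraph V) (v : V) : Prop :=
  ∀ a b, G.Adj v a → G.Adj v b → a ≠ b → ¬ G.Adj a b → ∀ u, u ∉ ({a, b} : Set V) →
    ∃ z, G.Adj z a ∧ G.Adj z b ∧ (avoid G {a, b}).Reachable u z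

lemma mem_compAvoiding_self {S : Set V} {m : V} : m ∈ compAvoiding G S m := .refl m

lemma subset_of_forall_adj {S T : Set V} {m : V} (hm : m ∈ T)
    (hT : ∀ y ∈ T, ∀ y', (avoid G S).Adj y y' → y' ∈ T) : compAvoiding G S m ⊆ T := by
  rintro u ⟨p⟩
  induction p with
  | nil => exact hm
  | cons h p ih => exact ih (hT _ hm _ h)

lemma notMem_of_mem_compAvoiding {S : Set V} {m u : V} (hm : m ∉ S)
    (hu : u ∈ compAvoiding G S m) : u ∉ S :=
  subset_of_forall_adj (T := Sᶜ) hm (fun _ _ _ h => h.2.2) hu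

lemma mem_compAvoiding_of_adj {S : Set V} {m u w : V} (hm : m ∉ S)
    (hu : u ∈ compAvoiding G S m) (huw : G.Adj u w) (hw : w ∉ S) : w ∈ compAvoiding G S m :=
  have h : (avoid G S).Adj u w := ⟨huw, notMem_of_mem_compAvoiding hm hu, hw⟩
  SimpleGraph.Reachable.trans hu h.reachable

lemma compAvoiding_subset {S S' : Set V} {m : V} (h : ∀ y ∈ compAvoiding G S m, y ∉ S') :
    compAvoiding G S m ⊆ compAvoiding G S' m := by
  intro u hu
  refine (subset_of_forall_adj (G := G) (S := S)
    (T := compAvoiding G S m ∩ compAvoiding G S' m) ⟨.refl m, .refl m⟩ ?_ hu).2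
  rintro y ⟨h1, h2⟩ y' hyy'
  have h3 : y' ∈ compAvoiding G S m := SimpleGraph.Reachable.trans h1 hyy'.reachable
  have h4 : (avoid G S').Adj y y' := ⟨hyy'.1, h y h1, h y' h3⟩
  exact ⟨h3, SimpleGraph.Reachable.trans h2 h4.reachable⟩

lemma exists_notMem_compAvoiding {S : Set V} {m : V} (hS : ¬ ConnectedAvoiding G S) :
    ∃ u, u ∉ S ∧ u ∉ compAvoiding G S m := by
  by_contra! h
  exact hS fun u hu w hw => ((h u hu).symm.trans (h w hw) : (avoid G S).Reachable u w)

lemma exists_adj_mem_compAvoiding_singleton (hG : G.Connected) {x m : V} (hm : m ≠ x) :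
    ∃ y ∈ compAvoiding G {x} m, G.Adj y x := by
  by_contra! h
  have he : avoid G ∅ = G := by ext; simp [avoid]
  have hx : x ∈ compAvoiding G ∅ m := by
    rw [compAvoiding, he]
    exact hG.preconnected m x
  exact notMem_of_mem_compAvoiding (G := G) (S := {x}) (m := m) hm
    (subset_of_forall_adj (.refl m) (fun y hy y' hyy' =>
      mem_compAvoiding_of_adj (S := {x}) hm hy hyy'.1
      (fun hy' => h y hy (Set.mem_singleton_iff.1 hy' ▸ hyy'.1))) hx) rfl

lemma exists_adj_mem_compAvoiding_pair {a b m : V} (hm : m ∉ ({a, b} : Set V)) (hab : a ≠ b)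
    (hb : ConnectedAvoiding G {b}) : ∃ y ∈ compAvoiding G {a, b} m, G.Adj y a := by
  by_contra! h
  have ha : a ∈ compAvoiding G {b} m := hb m (fun e => hm (.inr e)) a hab
  refine notMem_of_mem_compAvoiding (G := G) (S := {a, b}) (m := m) hm
    (subset_of_forall_adj (.refl m) (fun y hy y' hyy' => mem_compAvoiding_of_adj hm hy hyy'.1 ?_)
      ha) (.inl rfl)
  rintro (rfl | hy')
  · exact h y hy hyy'.1
  · exact hyy'.2.2 hy'

variable [Fintype V] [DecidableRel G.Adj]

/-- The set `B` stands for a part of the graph outside of which there are no cut vertices, except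
perhaps `x₀`. Among the separating pairs that leave `B` inside one component, take a pair
`a`, `b` and such a component `M` with `M` as large as possible. A pair of vertices outside `M`
other than `a`, `b` cannot separate, as it would leave a component larger than `M`. So a vertex
`v` on the other side is suitable unless `{a, b}` lies in its neighbourhood. If that is so for all
of these `v`, they form a clique of size `Δ - 1`, and `a` and `b` have just one neighbour each
in `M`; then one of `v`, `a`, `b` is suitable. -/
lemma exists_isSuitable_of_separating_pair {Δ : ℕ} (hΔ : 3 ≤ Δ) (hreg : ∀ v, G.degree v = Δ)
    {B : Set V} {x₀ : V}
    (h₁ : ∀ x m, m ≠ x → B ⊆ compAvoiding G {x} m → ConnectedAvoiding G {x})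
    (h₂ : ∀ a a', G.Adj a' a → a ∉ B → a' ≠ x₀ → ConnectedAvoiding G {a'})
    (hex : ∃ a b m, a ≠ b ∧ m ∉ ({a, b} : Set V) ∧ ¬ ConnectedAvoiding G {a, b} ∧
      B ⊆ compAvoiding G {a, b} m) : ∃ v, IsSuitable G v := by
  classical
  obtain ⟨⟨a, b, m⟩, hmem, hmax⟩ := Finset.exists_max_image
    (Finset.univ.filter fun t : V × V × V => t.1 ≠ t.2.1 ∧ t.2.2 ∉ ({t.1, t.2.1} : Set V) ∧
      ¬ ConnectedAvoiding G {t.1, t.2.1} ∧ B ⊆ compAvoiding G {t.1, t.2.1} t.2.2)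
    (fun t => (compAvoiding G {t.1, t.2.1} t.2.2).ncard)
    (by obtain ⟨a, b, m, h⟩ := hex; exact ⟨(a, b, m), by simpa using h⟩)
  simp only [Finset.mem_filter, Finset.mem_univ, true_and] at hmem hmax
  obtain ⟨hab, hm, hdis, hB⟩ := hmem
  set M := compAvoiding G {a, b} m with hM
  have haM : a ∉ M := fun h => notMem_of_mem_compAvoiding hm h (.inl rfl)
  have hbM : b ∉ M := fun h => notMem_of_mem_compAvoiding hm h (.inr rfl)
  have hmM : m ∈ M := mem_compAvoiding_self
  have hMb : M ⊆ compAvoiding G {b} m :=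
    compAvoiding_subset fun y hy e => hbM (by rwa [Set.mem_singleton_iff.1 e] at hy)
  have hMa : M ⊆ compAvoiding G {a} m :=
    compAvoiding_subset fun y hy e => haM (by rwa [Set.mem_singleton_iff.1 e] at hy)
  obtain ⟨a', ha'M, ha'⟩ := exists_adj_mem_compAvoiding_pair hm hab
    (h₁ b m (fun e => hm (.inr e)) (hB.trans hMb))
  obtain ⟨b', hb'M, hb'⟩ := exists_adj_mem_compAvoiding_pair (a := b) (b := a) (m := m)
    (by rwa [Set.pair_comm]) hab.symm (h₁ a m (fun e => hm (.inl e)) (hB.trans hMa))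
  rw [Set.pair_comm] at hb'M
  change a' ∈ M at ha'M
  change b' ∈ M at hb'M
  -- no other pair outside `M` separates
  have hconn : ∀ p r, p ∉ M → r ∉ M → p ≠ r → (a ∉ ({p, r} : Set V) ∨ b ∉ ({p, r} : Set V)) →
      ConnectedAvoiding G {p, r} := by
    intro p r hp hr hpr hor
    by_contra hnot
    have hm' : m ∉ ({p, r} : Set V) := by
      rintro (rfl | e)
      · exact hp hmM
      · exact hr (by rwa [Set.mem_singleton_iff.1 e] at hmM)
    have hsub : M ⊆ compAvoiding G {p, r} m := compAvoiding_subset fun y hy => by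
      rintro (rfl | e)
      · exact hp hy
      · exact hr (by rwa [Set.mem_singleton_iff.1 e] at hy)
    have hss : M ⊂ compAvoiding G {p, r} m := by
      refine ⟨hsub, fun hsup => ?_⟩
      rcases hor with h | h
      · exact haM (hsup (mem_compAvoiding_of_adj hm' (hsub ha'M) ha' h))
      · exact hbM (hsup (mem_compAvoiding_of_adj hm' (hsub hb'M) hb' h))
    have h1 := hmax (p, r, m) ⟨hpr, hm', hnot, hB.trans hsub⟩
    have h2 := Set.ncard_lt_ncard hss (Set.toFinite _)
    simp only at h1
    omega
  set D : Finset V := Finset.univ.filter fun u => u ∉ M ∧ u ≠ a ∧ u ≠ b with hD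
  have hmemD : ∀ u, u ∈ D ↔ u ∉ M ∧ u ≠ a ∧ u ≠ b := fun u => by simp [hD]
  obtain ⟨v, hvD⟩ : D.Nonempty := by
    obtain ⟨u, hu, hu'⟩ := exists_notMem_compAvoiding (m := m) hdis
    exact ⟨u, (hmemD u).2 ⟨hu', fun e => hu (.inl e), fun e => hu (.inr e)⟩⟩
  have hDM : ∀ u ∈ D, ∀ w, G.Adj u w → w ∉ M := fun u hu w huw hw =>
    ((hmemD u).1 hu).1 (mem_compAvoiding_of_adj hm hw huw.symm (by
      rintro (e | e)
      · exact ((hmemD u).1 hu).2.1 e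
      · exact ((hmemD u).1 hu).2.2 e))
  by_cases hall : ∃ u ∈ D, ¬ (G.Adj u a ∧ G.Adj u b)
  · obtain ⟨u, hu, hnadj⟩ := hall
    refine ⟨u, fun p r hp hr hpr _ y hy => ⟨u, hp, hr, ?_⟩⟩
    refine hconn p r (hDM u hu p hp) (hDM u hu r hr) hpr ?_ y hy u ?_
    · by_contra! h
      refine hnadj ⟨?_, ?_⟩
      · rcases h.1 with e | e
        · rwa [e]
        · rwa [Set.mem_singleton_iff.1 e]
      · rcases h.2 with e | e
        · rwa [e]
        · rwa [Set.mem_singleton_iff.1 e]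
    · rintro (e | e)
      · exact hp.ne e
      · exact hr.ne e
  push Not at hall
  by_cases hcom : ∃ y ∈ M, G.Adj y a ∧ G.Adj y b
  · -- both sides of the separation contain common neighbours of `a` and `b`
    obtain ⟨y, hyM, hya, hyb⟩ := hcom
    have hpair : ∀ u, u ∉ ({a, b} : Set V) →
        ∃ z, G.Adj z a ∧ G.Adj z b ∧ (avoid G {a, b}).Reachable u z := by
      intro u hu
      by_cases huM : u ∈ M
      · exact ⟨y, hya, hyb, SimpleGraph.Reachable.trans (SimpleGraph.Reachable.symm huM) hyM⟩
      · have huD : u ∈ D := (hmemD u).2 ⟨huM, fun e => hu (.inl e), fun e => hu (.inr e)⟩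
        exact ⟨u, (hall u huD).1, (hall u huD).2, .refl u⟩
    refine ⟨v, fun p r hp hr hpr _ u hu => ?_⟩
    by_cases hor : a ∉ ({p, r} : Set V) ∨ b ∉ ({p, r} : Set V)
    · refine ⟨v, hp, hr, hconn p r (hDM v hvD p hp) (hDM v hvD r hr) hpr hor u hu v ?_⟩
      rintro (e | e)
      · exact hp.ne e
      · exact hr.ne e
    · push Not at hor
      simp only [Set.mem_insert_iff, Set.mem_singleton_iff] at hor
      obtain ⟨h1, h2⟩ := hor
      rcases h1 with rfl | rfl
      · have : b = r := h2.resolve_left hab.symm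
        subst this
        exact hpair u hu
      · have : b = p := h2.resolve_right hab.symm
        subst this
        rw [Set.pair_comm] at hu ⊢
        obtain ⟨z, hz1, hz2, hz3⟩ := hpair u hu
        exact ⟨z, hz2, hz1, hz3⟩
  push Not at hcom
  -- now `D` is a clique on `Δ - 1` vertices
  have ha'D : a' ∉ D := fun h => ((hmemD a').1 h).1 ha'M
  have hb'D : b' ∉ D := fun h => ((hmemD b').1 h).1 hb'M
  have hNa : insert a' D ⊆ G.neighborFinset a := by
    intro u hu
    rw [SimpleGraph.mem_neighborFinset]
    rcases Finset.mem_insert.1 hu with rfl | hu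
    · exact ha'.symm
    · exact (hall u hu).1.symm
  have hNb : insert b' D ⊆ G.neighborFinset b := by
    intro u hu
    rw [SimpleGraph.mem_neighborFinset]
    rcases Finset.mem_insert.1 hu with rfl | hu
    · exact hb'.symm
    · exact (hall u hu).2.symm
  have hNv : ∀ u ∈ D, G.neighborFinset u ⊆ insert a (insert b (D.erase u)) := by
    intro u hu w hw
    rw [SimpleGraph.mem_neighborFinset] at hw
    by_cases h1 : w = a
    · simp [h1]
    by_cases h2 : w = b
    · simp [h2]
    have := (hmemD w).2 ⟨hDM u hu w hw, h1, h2⟩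
    simp [this, hw.ne']
  have hcard : ∀ u, (G.neighborFinset u).card = Δ := fun u => by
    rw [SimpleGraph.card_neighborFinset_eq_degree, hreg]
  have hcv : ∀ u ∈ D, (insert a (insert b (D.erase u))).card ≤ D.card + 1 := fun u hu => by
    have h1 := Finset.card_insert_le a (insert b (D.erase u))
    have h2 := Finset.card_insert_le b (D.erase u)
    have h3 := Finset.card_erase_add_one hu
    omega
  have hge : Δ ≤ D.card + 1 := by
    have := Finset.card_le_card (hNv v hvD)
    rw [hcard] at this
    exact this.trans (hcv v hvD)
  have hle : D.card + 1 ≤ Δ := by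
    have := Finset.card_le_card hNa
    rwa [hcard, Finset.card_insert_of_notMem ha'D] at this
  have hNa' := Finset.eq_of_subset_of_card_le hNa
    (by rw [hcard, Finset.card_insert_of_notMem ha'D]; exact hge)
  have hNb' := Finset.eq_of_subset_of_card_le hNb
    (by rw [hcard, Finset.card_insert_of_notMem hb'D]; exact hge)
  have hclique : ∀ u ∈ D, ∀ w ∈ D, u ≠ w → G.Adj u w := by
    intro u hu w hw huw
    have := Finset.eq_of_subset_of_card_le (hNv u hu) (by rw [hcard]; have := hcv u hu; omega)
    rw [← SimpleGraph.mem_neighborFinset, this]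
    simp [hw, huw.symm]
  -- an end of the clique whose outer neighbour is no cut vertex is suitable
  have key : ∀ a b a', a ∉ B → insert a' D = G.neighborFinset a → (∀ u ∈ D, G.Adj u b) →
      a ≠ b → a' ≠ b → a' ∉ D → b ∉ D →
      (∀ u ∈ D, ∀ w, G.Adj u w → w = a ∨ w = b ∨ w ∈ D) → a' ≠ x₀ → IsSuitable G a := by
    intro a b a' haB hNa hbD hab ha'b ha'D hbD' hND ha'x
    have hadj : ∀ u, G.Adj a u ↔ u = a' ∨ u ∈ D := fun u => by
      rw [← SimpleGraph.mem_neighborFinset, ← hNa, Finset.mem_insert]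
    have haa' : G.Adj a a' := (hadj a').2 (.inl rfl)
    have hca' := h₂ a a' haa'.symm haB ha'x
    have hpair : ∀ e ∈ D, ∀ u, u ∉ ({a', e} : Set V) → (avoid G {a', e}).Reachable u a := by
      intro e he u hu
      have hae : G.Adj a e := (hadj e).2 (.inr he)
      have haS : a ∉ ({a', e} : Set V) := by
        rintro (h | h)
        · exact haa'.ne h
        · exact hae.ne h
      have hbS : b ∉ ({a', e} : Set V) := by
        rintro (h | h)
        · exact ha'b h.symm
        · exact hbD' (by rw [Set.mem_singleton_iff.1 h]; exact he)
      obtain ⟨e₂, he₂, hne⟩ : ∃ e₂ ∈ D, e₂ ≠ e :=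
        Finset.exists_mem_ne (by omega) e
      have hstep : ∀ d ∈ D, d ≠ e → d ∈ compAvoiding G {a', e} a := fun d hd hde =>
        mem_compAvoiding_of_adj haS mem_compAvoiding_self ((hadj d).2 (.inr hd)) (by
          rintro (h | h)
          · exact ha'D (h ▸ hd)
          · exact hde h)
      have hsub : compAvoiding G {a'} a ⊆ insert e (compAvoiding G {a', e} a) := by
        refine subset_of_forall_adj (.inr mem_compAvoiding_self) ?_
        intro y hy y' hyy'
        by_cases hy'e : y' = e
        · exact .inl hy'e
        right
        rcases hy with rfl | hy
        · rcases hND y he y' hyy'.1 with rfl | rfl | h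
          · exact mem_compAvoiding_self
          · exact mem_compAvoiding_of_adj haS (hstep e₂ he₂ hne) (hbD e₂ he₂) hbS
          · exact hstep y' h hy'e
        · refine mem_compAvoiding_of_adj haS hy hyy'.1 ?_
          rintro (h | h)
          · exact hyy'.2.2 h
          · exact hy'e h
      rcases hsub (hca' a haa'.ne u (fun h => hu (.inl h))) with h | h
      · exact absurd (Or.inr h) hu
      · exact SimpleGraph.Reachable.symm h
    intro p r hp hr hpr hnadj u hu
    refine ⟨a, hp, hr, ?_⟩
    rcases (hadj p).1 hp with rfl | hp'
    · rcases (hadj r).1 hr with rfl | hr'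
      · exact absurd rfl hpr
      · exact hpair r hr' u hu
    · rcases (hadj r).1 hr with rfl | hr'
      · rw [Set.pair_comm] at hu ⊢
        exact hpair p hp' u hu
      · exact absurd (hclique p hp' r hr' hpr) hnadj
  have hND : ∀ u ∈ D, ∀ w, G.Adj u w → w = a ∨ w = b ∨ w ∈ D := by
    intro u hu w huw
    have := hNv u hu ((SimpleGraph.mem_neighborFinset ..).2 huw)
    simp only [Finset.mem_insert, Finset.mem_erase] at this
    tauto
  by_cases hx : a' = x₀
  · have hb'x : b' ≠ x₀ := fun e => hcom a' ha'M ha' (by rwa [hx, ← e])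
    exact ⟨b, key b a b' (fun h => hbM (hB h)) hNb' (fun u hu => (hall u hu).1) hab.symm
      (fun e => haM (e ▸ hb'M)) hb'D (by simp [hD]) (fun u hu w huw => by
        have := hND u hu w huw; tauto) hb'x⟩
  · exact ⟨a, key a b a' (fun h => haM (hB h)) hNa' (fun u hu => (hall u hu).2) hab
      (fun e => hbM (e ▸ ha'M)) ha'D (by simp [hD]) hND hx⟩

/-- If there is a cut vertex, take `B` to be a largest component `M₀` behind a cut vertex `x₀`
together with `x₀`; otherwise let `B` be empty. -/
lemma exists_isSuitable (hG : G.Connected) {Δ : ℕ} (hΔ : 3 ≤ Δ) (hreg : ∀ v, G.degree v = Δ) :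
    ∃ v, IsSuitable G v := by
  classical
  have suitable : ∀ v, (∀ p r, G.Adj v p → G.Adj v r → p ≠ r → ConnectedAvoiding G {p, r}) →
      IsSuitable G v := by
    refine fun v h p r hp hr hpr _ u hu => ⟨v, hp, hr, h p r hp hr hpr u hu v ?_⟩
    rintro (e | e)
    · exact hp.ne e
    · exact hr.ne e
  by_cases hcut : ∀ x, ConnectedAvoiding G {x}
  · obtain ⟨x₀⟩ := hG.nonempty
    by_cases hpair : ∃ a b : V, a ≠ b ∧ ¬ ConnectedAvoiding G {a, b}
    · obtain ⟨a, b, hab, hdis⟩ := hpair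
      obtain ⟨m, hm, -⟩ := exists_notMem_compAvoiding (m := a) hdis
      exact exists_isSuitable_of_separating_pair hΔ hreg (B := ∅) (x₀ := x₀)
        (fun x _ _ _ => hcut x) (fun _ a' _ _ _ => hcut a')
        ⟨a, b, m, hab, hm, hdis, Set.empty_subset _⟩
    · push Not at hpair
      exact ⟨x₀, suitable x₀ fun p r _ _ hpr => hpair p r hpr⟩
  obtain ⟨⟨x₀, m₀⟩, hmem, hmax⟩ := Finset.exists_max_image
    (Finset.univ.filter fun t : V × V => t.2 ≠ t.1 ∧ ¬ ConnectedAvoiding G {t.1})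
    (fun t => (compAvoiding G {t.1} t.2).ncard) (by
      push Not at hcut
      obtain ⟨x, hx⟩ := hcut
      obtain ⟨m, hm, -⟩ := exists_notMem_compAvoiding (m := x) hx
      exact ⟨(x, m), by simpa using ⟨hm, hx⟩⟩)
  simp only [Finset.mem_filter, Finset.mem_univ, true_and] at hmem hmax
  obtain ⟨hm₀, hdis⟩ := hmem
  set M := compAvoiding G {x₀} m₀ with hM
  have hxM : x₀ ∉ M := fun h => notMem_of_mem_compAvoiding (S := {x₀}) hm₀ h rfl
  obtain ⟨y₀, hy₀M, hy₀⟩ := exists_adj_mem_compAvoiding_singleton hG hm₀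
  change y₀ ∈ M at hy₀M
  have hB : ∀ S : Set V, (∀ u ∈ S, u ∉ insert x₀ M) → insert x₀ M ⊆ compAvoiding G S m₀ := by
    intro S hS
    have hsub : M ⊆ compAvoiding G S m₀ :=
      compAvoiding_subset fun y hy hyS => hS y hyS (.inr hy)
    rintro u (rfl | hu)
    · exact mem_compAvoiding_of_adj (fun h => hS m₀ h (.inr mem_compAvoiding_self)) (hsub hy₀M) hy₀
        (fun h => hS u h (.inl rfl))
    · exact hsub hu
  have h₁ : ∀ x m, m ≠ x → insert x₀ M ⊆ compAvoiding G {x} m → ConnectedAvoiding G {x} := by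
    intro x m hmx hsub
    by_contra hnot
    have hss : M ⊂ compAvoiding G {x} m :=
      ⟨(Set.subset_insert _ _).trans hsub, fun h => hxM (h (hsub (.inl rfl)))⟩
    have h1 := hmax (x, m) ⟨hmx, hnot⟩
    have h2 := Set.ncard_lt_ncard hss (Set.toFinite _)
    simp only at h1
    omega
  have hclosed : ∀ a a', G.Adj a' a → a ∉ insert x₀ M → a' ∉ M := fun a a' haa' ha ha' =>
    ha (.inr (mem_compAvoiding_of_adj (S := {x₀}) hm₀ ha' haa' (fun h => ha (.inl h))))
  have h₂ : ∀ a a', G.Adj a' a → a ∉ insert x₀ M → a' ≠ x₀ → ConnectedAvoiding G {a'} := by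
    intro a a' haa' ha ha'
    have ha'M := hclosed a a' haa' ha
    have hnot : a' ∉ insert x₀ M := by
      rintro (h | h)
      · exact ha' h
      · exact ha'M h
    refine h₁ a' m₀ (fun e => ha'M (e ▸ mem_compAvoiding_self)) (hB {a'} ?_)
    rintro u rfl
    exact hnot
  by_cases hpair : ∃ a b m, a ≠ b ∧ m ∉ ({a, b} : Set V) ∧ ¬ ConnectedAvoiding G {a, b} ∧
      insert x₀ M ⊆ compAvoiding G {a, b} m
  · exact exists_isSuitable_of_separating_pair hΔ hreg h₁ h₂ hpair
  push Not at hpair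
  -- `x₀` has a neighbour in `M`, so it is not adjacent to all other vertices
  set D : Finset V := Finset.univ.filter fun u => u ∉ insert x₀ M with hD
  have hmemD : ∀ u, u ∈ D ↔ u ∉ insert x₀ M := fun u => by simp only [hD, Finset.mem_filter_univ]
  obtain ⟨v, hvD⟩ : D.Nonempty := by
    obtain ⟨u, hu, hu'⟩ := exists_notMem_compAvoiding (m := m₀) hdis
    refine ⟨u, (hmemD u).2 ?_⟩
    rintro (h | h)
    · exact hu h
    · exact hu' h
  obtain ⟨v, hvD, hvx⟩ : ∃ v ∈ D, ¬ G.Adj v x₀ := by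
    by_contra! hall
    have h1 : insert y₀ D ⊆ G.neighborFinset x₀ := by
      intro u hu
      rw [SimpleGraph.mem_neighborFinset]
      rcases Finset.mem_insert.1 hu with rfl | hu
      · exact hy₀.symm
      · exact (hall u hu).symm
    have h2 : G.neighborFinset v ⊆ insert x₀ (D.erase v) := by
      intro w hw
      rw [SimpleGraph.mem_neighborFinset] at hw
      by_cases hwx : w = x₀
      · simp [hwx]
      refine Finset.mem_insert_of_mem (Finset.mem_erase.2 ⟨hw.ne', (hmemD w).2 ?_⟩)
      rintro (h | h)
      · exact hwx h
      · exact hclosed v w hw.symm ((hmemD v).1 hvD) h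
    have h3 := Finset.card_le_card h1
    have h4 := Finset.card_le_card h2
    have h5 := Finset.card_insert_le x₀ (D.erase v)
    have h6 := Finset.card_erase_add_one hvD
    rw [SimpleGraph.card_neighborFinset_eq_degree, hreg] at h3 h4
    rw [Finset.card_insert_of_notMem (fun h => (hmemD y₀).1 h (.inr hy₀M))] at h3
    omega
  refine ⟨v, suitable v fun p r hp hr hpr => ?_⟩
  have hnot : ∀ w, G.Adj v w → w ∉ insert x₀ M := by
    rintro w hw (h | h)
    · exact hvx (h ▸ hw)
    · exact hclosed v w hw.symm ((hmemD v).1 hvD) h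
  have hS : ∀ u ∈ ({p, r} : Set V), u ∉ insert x₀ M := by
    rintro u (rfl | hu)
    · exact hnot u hp
    · rw [Set.mem_singleton_iff.1 hu]
      exact hnot r hr
  by_contra hnc
  exact hpair p r m₀ hpr (fun h => hS m₀ h (.inr mem_compAvoiding_self)) hnc (hB _ hS)

end Separation

/-! ### Regular graphs of degree at least three -/

section Regular

variable {V : Type*} [Fintype V] {G : SimpleGraph V} [DecidableRel G.Adj]

/-- Freeness is moved to a suitable vertex `v`. Then two neighbours of `v` share a colour, and these
two are kept fixed. -/
lemma exists_reachIn_of_regular (hG : G.Connected) {Δ : ℕ} (hΔ : 3 ≤ Δ)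
    (hreg : ∀ v, G.degree v = Δ) {α : G.Coloring (Fin (Δ + 1))} (hα : ¬ IsFrozen α) :
    ∃ (q : _) (β : _), ReachIn (Fintype.card V + 2 * Fintype.card V ^ 2) α β ∧ ∀ u, β u ≠ q := by
  have hdeg : ∀ v, G.degree v + 1 ≤ Δ + 1 := fun v => by rw [hreg]
  obtain ⟨v, hv⟩ := exists_isSuitable hG hΔ hreg
  obtain ⟨f, hf⟩ := exists_isFree_of_not_isFrozen hα
  obtain ⟨p, hp⟩ := hG.exists_isPath v f
  obtain ⟨β, h1, h2⟩ := exists_isFree_of_walk hdeg p hf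
  obtain ⟨a, b, ha, hb, hab, he⟩ := exists_eq_of_isFree (by rw [hreg]) h2
  obtain ⟨q, β', h3, h4⟩ := exists_reachIn_of_monochromatic (by omega) hdeg (F := {a, b}) (α := β)
    (by
      rintro u (rfl | rfl) w (rfl | rfl)
      · rfl
      · exact he
      · exact he.symm
      · rfl)
    (fun u hu => by
      obtain ⟨z, hza, hzb, hz⟩ := hv a b ha hb hab (fun h => β.valid h he) u hu
      exact ⟨z, ⟨a, .inl rfl, b, .inr rfl, hab, hza, hzb⟩, hz⟩)
  exact ⟨q, β', (h1.mono hp.length_lt.le).trans h3, h4⟩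

/-- Greedy colouring, starting with equal colours on two nonadjacent vertices. -/
lemma exists_coloring_eq {k : ℕ} (hdeg : ∀ v, G.degree v + 1 ≤ k) {a b : V} (hab : ¬ G.Adj a b) :
    ∃ α : G.Coloring (Fin k), α a = α b := by
  classical
  have hk : 0 < k := by have := hdeg a; omega
  suffices H : ∀ S : Finset V, ∃ f : V → Fin k, f a = f b ∧
      ∀ u w, (u = a ∨ u = b ∨ u ∈ S) → (w = a ∨ w = b ∨ w ∈ S) → G.Adj u w → f u ≠ f w by
    obtain ⟨f, h1, h2⟩ := H Finset.univ
    exact ⟨SimpleGraph.Coloring.mk f fun {u w} h => h2 u w (by simp) (by simp) h, h1⟩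
  intro S
  induction S using Finset.induction_on with
  | empty =>
    refine ⟨fun _ => ⟨0, hk⟩, rfl, ?_⟩
    rintro u w (rfl | rfl | hu) (rfl | rfl | hw) h
    · exact absurd rfl h.ne
    · exact absurd h hab
    · simp at hw
    · exact absurd h.symm hab
    · exact absurd rfl h.ne
    · simp at hw
    all_goals simp at hu
  | insert v S hv ih =>
    obtain ⟨f, h1, h2⟩ := ih
    by_cases hvab : v = a ∨ v = b
    · have hmem : ∀ u, (u = a ∨ u = b ∨ u ∈ insert v S) → u = a ∨ u = b ∨ u ∈ S := by
        intro u hu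
        rw [Finset.mem_insert] at hu
        rcases hvab with rfl | rfl <;> tauto
      exact ⟨f, h1, fun u w hu hw => h2 u w (hmem u hu) (hmem w hw)⟩
    obtain ⟨hva, hvb⟩ := not_or.1 hvab
    obtain ⟨c, hc⟩ : ∃ c, c ∉ (G.neighborFinset v).image f := by
      by_contra! hall
      have h3 := Finset.card_le_card (fun c _ => hall c : (Finset.univ : Finset (Fin k)) ⊆ _)
      have h4 := Finset.card_image_le (s := G.neighborFinset v) (f := f)
      rw [Finset.card_univ, Fintype.card_fin] at h3
      rw [SimpleGraph.card_neighborFinset_eq_degree] at h4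
      have := hdeg v
      omega
    have hc' : ∀ w, G.Adj v w → f w ≠ c := fun w hw h =>
      hc (Finset.mem_image.2 ⟨w, by simpa using hw, h⟩)
    refine ⟨Function.update f v c, ?_, fun u w hu hw huw => ?_⟩
    · rw [Function.update_of_ne (Ne.symm hva), Function.update_of_ne (Ne.symm hvb), h1]
    rw [Finset.mem_insert] at hu hw
    by_cases huv : u = v
    · subst huv
      rw [Function.update_self, Function.update_of_ne huw.ne']
      exact (hc' w huw).symm
    by_cases hwv : w = v
    · subst hwv
      rw [Function.update_self, Function.update_of_ne huw.ne]
      exact hc' u huw.symm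
    · rw [Function.update_of_ne huv, Function.update_of_ne hwv]
      exact h2 u w (by tauto) (by tauto) huw

lemma not_isFrozen_of_eq {k : ℕ} (hdeg : ∀ v, G.degree v + 1 ≤ k) {α : G.Coloring (Fin k)}
    {v a b : V} (ha : G.Adj v a) (hb : G.Adj v b) (hab : a ≠ b) (he : α a = α b) :
    ¬ IsFrozen α := by
  intro hfr
  refine ne_of_not_isFree (hdeg v) ?_ ha hb hab he
  rintro ⟨c, hc, h⟩
  obtain ⟨w, hw, hwc⟩ := hfr v c hc
  exact h w hw hwc

lemma nonempty_iso_completeGraph (hG : G.Connected) {Δ : ℕ} (hreg : ∀ v, G.degree v = Δ)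
    (h : ∀ v a b, G.Adj v a → G.Adj v b → a ≠ b → G.Adj a b) :
    Nonempty (G ≃g SimpleGraph.completeGraph (Fin (Δ + 1))) := by
  classical
  have hwalk : ∀ u w, G.Walk u w → u = w ∨ G.Adj u w := by
    intro u w p
    induction p with
    | nil => exact .inl rfl
    | @cons u x w hux p ih =>
      by_cases huw : u = w
      · exact .inl huw
      right
      rcases ih with rfl | hxw
      · exact hux
      · exact h x u w hux.symm hxw huw
  have hadj : ∀ u w, G.Adj u w ↔ u ≠ w := fun u w =>
    ⟨fun h => h.ne, fun hne => (hwalk u w (hG.preconnected u w).some).resolve_left hne⟩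
  obtain ⟨v⟩ := hG.nonempty
  have hN : G.neighborFinset v = Finset.univ.erase v := by
    ext w
    simp [hadj, eq_comm]
  have hcard : Fintype.card V = Δ + 1 := by
    have h1 := Finset.card_erase_add_one (Finset.mem_univ v)
    rw [← hN, SimpleGraph.card_neighborFinset_eq_degree, hreg, Finset.card_univ] at h1
    exact h1.symm
  exact ⟨⟨Fintype.equivFinOfCardEq hcard, by simp [hadj]⟩⟩

end Regular

/-! ### Cycles -/

section Cycles

variable {V : Type*} [Fintype V] {G : SimpleGraph V} [DecidableRel G.Adj]

lemma nonempty_iso_cycleGraph (hG : G.Connected) (hreg : ∀ v, G.degree v = 2) :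
    3 ≤ Fintype.card V ∧ Nonempty (G ≃g SimpleGraph.cycleGraph (Fintype.card V)) := by
  classical
  have hncard : ∀ v, (G.neighborSet v).ncard = 2 := fun v => by
    rw [← hreg v, ← SimpleGraph.card_neighborSet_eq_degree, Set.ncard_eq_toFinset_card',
      Set.toFinset_card]
  have hcyc : G.IsCycles := fun v _ => hncard v
  obtain ⟨v⟩ := hG.nonempty
  obtain ⟨p, hp, hverts⟩ := hcyc.exists_cycle_toSubgraph_verts_eq_connectedComponentSupp
    (c := G.connectedComponentMk v) (v := v) rfl
    (Set.nonempty_of_ncard_ne_zero (by rw [hncard]; norm_num))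
  have hall : ∀ u, u ∈ p.support := fun u => by
    rw [← SimpleGraph.Walk.mem_verts_toSubgraph, hverts]
    exact SimpleGraph.ConnectedComponent.sound (hG.preconnected u v)
  have htail : ∀ u, u ∈ p.support.tail := fun u => by
    have h1 := hall u
    rw [← SimpleGraph.Walk.cons_tail_support, List.mem_cons] at h1
    rcases h1 with rfl | h1
    · exact SimpleGraph.Walk.end_mem_tail_support hp.not_nil
    · exact h1
  have hlen : p.length = Fintype.card V := by
    rw [← Finset.card_univ, ← Finset.eq_univ_of_forall (s := p.support.tail.toFinset)
      (fun u => by simpa using htail u), List.toFinset_card_of_nodup hp.support_nodup,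
      List.length_tail, SimpleGraph.Walk.length_support]
    omega
  have h3 : 3 ≤ Fintype.card V := hlen ▸ hp.three_le_length
  refine ⟨h3, ?_⟩
  obtain ⟨f⟩ := (SimpleGraph.cycleGraph_isContained_iff h3).2 ⟨v, p, hp, hlen⟩
  have hbij : Function.Bijective f :=
    (Fintype.bijective_iff_injective_and_card f).2 ⟨f.injective, by simp⟩
  obtain ⟨n, hn⟩ : ∃ n, Fintype.card V = n + 3 := ⟨_, (Nat.sub_add_cancel h3).symm⟩
  have hdegC : ∀ i, (SimpleGraph.cycleGraph (Fintype.card V)).degree i = 2 := by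
    rw [hn]
    intro i
    exact SimpleGraph.cycleGraph_degree_three_le
  have hN : ∀ i, ((SimpleGraph.cycleGraph (Fintype.card V)).neighborFinset i).image f =
      G.neighborFinset (f i) := by
    intro i
    refine Finset.eq_of_subset_of_card_le ?_ ?_
    · intro u hu
      obtain ⟨j, hj, rfl⟩ := Finset.mem_image.1 hu
      rw [SimpleGraph.mem_neighborFinset] at hj ⊢
      exact f.toHom.map_adj hj
    · rw [Finset.card_image_of_injective _ hbij.injective,
        SimpleGraph.card_neighborFinset_eq_degree, SimpleGraph.card_neighborFinset_eq_degree,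
        hreg, hdegC]
  refine ⟨SimpleGraph.Iso.symm ⟨Equiv.ofBijective f hbij, fun {i j} => ?_⟩⟩
  rw [Equiv.ofBijective_apply, Equiv.ofBijective_apply, ← SimpleGraph.mem_neighborFinset, ← hN,
    Finset.mem_image, ← SimpleGraph.mem_neighborFinset]
  constructor
  · rintro ⟨l, hl, he⟩
    rwa [← hbij.injective he]
  · exact fun h => ⟨j, h, rfl⟩

/-- In a proper 3-colouring of the 4-cycle two opposite vertices share a colour. -/
lemma exists_reachIn_of_iso_cycleGraph_four (e : G ≃g SimpleGraph.cycleGraph 4)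
    (hdeg : ∀ v, G.degree v + 1 ≤ 3) (α : G.Coloring (Fin 3)) :
    ∃ (q : Fin 3) (β : _), ReachIn (2 * Fintype.card V ^ 2) α β ∧ ∀ u, β u ≠ q := by
  have hadj : ∀ i j, (SimpleGraph.cycleGraph 4).Adj i j → G.Adj (e.symm i) (e.symm j) :=
    fun i j h => e.symm.map_adj_iff.2 h
  have hcol : ∀ i j, (SimpleGraph.cycleGraph 4).Adj i j → α (e.symm i) ≠ α (e.symm j) :=
    fun i j h => α.valid (hadj i j h)
  have hdec : ∀ c₀ c₁ c₂ c₃ : Fin 3, c₀ ≠ c₁ → c₁ ≠ c₂ → c₂ ≠ c₃ → c₃ ≠ c₀ →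
      c₀ = c₂ ∨ c₁ = c₃ := by decide
  have hopp : ∃ i, α (e.symm i) = α (e.symm (i + 2)) := by
    rcases hdec _ _ _ _ (hcol 0 1 (by decide)) (hcol 1 2 (by decide)) (hcol 2 3 (by decide))
      (hcol 3 0 (by decide)) with h | h
    · exact ⟨0, h⟩
    · exact ⟨1, h⟩
  obtain ⟨i, hi⟩ := hopp
  refine exists_reachIn_of_monochromatic (by norm_num) hdeg (F := {e.symm i, e.symm (i + 2)}) ?_ ?_
  · rintro u (rfl | rfl) w (rfl | rfl)
    · rfl
    · exact hi
    · exact hi.symm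
    · rfl
  · intro v hv
    obtain ⟨j, rfl⟩ := e.symm.surjective v
    have hj : j ≠ i ∧ j ≠ i + 2 := by
      constructor
      · rintro rfl
        exact hv (.inl rfl)
      · rintro rfl
        exact hv (.inr rfl)
    have hdec : ∀ i j : Fin 4, j ≠ i → j ≠ i + 2 → i ≠ i + 2 ∧
        (SimpleGraph.cycleGraph 4).Adj j i ∧ (SimpleGraph.cycleGraph 4).Adj j (i + 2) := by decide
    obtain ⟨h1, h2, h3⟩ := hdec i j hj.1 hj.2
    exact ⟨_, ⟨_, .inl rfl, _, .inr rfl, fun h => h1 (e.symm.injective h), hadj _ _ h2,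
      hadj _ _ h3⟩, .refl _⟩

/-- In a 3-colouring of the 6-cycle that is not frozen, two vertices at distance two share a colour,
and the third vertex of the same parity has that colour or can be given it. -/
lemma exists_reachIn_of_iso_cycleGraph_six (e : G ≃g SimpleGraph.cycleGraph 6)
    (hreg : ∀ v, G.degree v = 2) {α : G.Coloring (Fin 3)} (hα : ¬ IsFrozen α) :
    ∃ (q : Fin 3) (β : _), ReachIn (1 + 2 * Fintype.card V ^ 2) α β ∧ ∀ u, β u ≠ q := by
  have hadj : ∀ i j, G.Adj (e.symm i) (e.symm j) ↔ (SimpleGraph.cycleGraph 6).Adj i j :=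
    fun i j => e.symm.map_adj_iff
  have hnbr : ∀ i j : Fin 6, (SimpleGraph.cycleGraph 6).Adj i j ↔ j = i + 1 ∨ j = i + 5 := by
    decide
  obtain ⟨f, hf⟩ := exists_isFree_of_not_isFrozen hα
  obtain ⟨a, b, ha, hb, hab, he⟩ := exists_eq_of_isFree (by rw [hreg]) hf
  obtain ⟨j, rfl⟩ := e.symm.surjective f
  have h15 : α (e.symm (j + 1)) = α (e.symm (j + 5)) := by
    obtain ⟨i, rfl⟩ := e.symm.surjective a
    obtain ⟨l, rfl⟩ := e.symm.surjective b
    rw [hadj, hnbr] at ha hb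
    rcases ha with rfl | rfl <;> rcases hb with rfl | rfl
    · exact absurd rfl hab
    · exact he
    · exact he.symm
    · exact absurd rfl hab
  have hcol : ∀ i l, (SimpleGraph.cycleGraph 6).Adj i l → α (e.symm i) ≠ α (e.symm l) :=
    fun i l h => α.valid ((hadj i l).2 h)
  have hsteps : ∀ j : Fin 6, (SimpleGraph.cycleGraph 6).Adj (j + 1) (j + 2) ∧
      (SimpleGraph.cycleGraph 6).Adj (j + 2) (j + 3) ∧
      (SimpleGraph.cycleGraph 6).Adj (j + 3) (j + 4) ∧
      (SimpleGraph.cycleGraph 6).Adj (j + 4) (j + 5) ∧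
      j + 1 ≠ j + 3 ∧ j + 5 ≠ j + 3 ∧ j + 3 + 1 = j + 4 ∧ j + 3 + 5 = j + 2 := by decide
  obtain ⟨s1, s2, s3, s4, s5, s6, s7, s8⟩ := hsteps j
  obtain ⟨β, hβ, hβ1, hβ3, hβ5⟩ : ∃ β : G.Coloring (Fin 3), ReachIn 1 α β ∧
      β (e.symm (j + 1)) = α (e.symm (j + 1)) ∧ β (e.symm (j + 3)) = α (e.symm (j + 1)) ∧
      β (e.symm (j + 5)) = α (e.symm (j + 1)) := by
    obtain ⟨β, t1, t2, t3⟩ := exists_recolor α (v := e.symm (j + 3)) (c := α (e.symm (j + 1)))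
      (fun w hw => by
        obtain ⟨i, rfl⟩ := e.symm.surjective w
        rw [hadj, hnbr] at hw
        rcases hw with rfl | rfl
        · rw [s7, h15]
          exact hcol _ _ s4
        · rw [s8]
          exact (hcol _ _ s1).symm)
    exact ⟨β, t1, t3 _ fun h => s5 (e.symm.injective h), t2,
      (t3 _ fun h => s6 (e.symm.injective h)).trans h15.symm⟩
  obtain ⟨q, β', h1, h2⟩ := exists_reachIn_of_monochromatic (k := 3) (by norm_num)
    (fun v => by rw [hreg]) (F := {e.symm (j + 1), e.symm (j + 3), e.symm (j + 5)}) (α := β) (by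
      rintro u (rfl | rfl | rfl) w (rfl | rfl | rfl) <;> simp only [hβ1, hβ3, hβ5])
    (fun v hv => by
      obtain ⟨i, rfl⟩ := e.symm.surjective v
      have hdec : ∀ i j : Fin 6, i = j + 1 ∨ i = j + 3 ∨ i = j + 5 ∨
          ((i + 1 = j + 1 ∨ i + 1 = j + 3 ∨ i + 1 = j + 5) ∧
            (i + 5 = j + 1 ∨ i + 5 = j + 3 ∨ i + 5 = j + 5) ∧ i + 1 ≠ i + 5) := by decide
      have hF : ∀ l, l = j + 1 ∨ l = j + 3 ∨ l = j + 5 →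
          e.symm l ∈ ({e.symm (j + 1), e.symm (j + 3), e.symm (j + 5)} : Set V) := by
        rintro l (rfl | rfl | rfl) <;> simp
      rcases hdec i j with h | h | h | ⟨h1, h2, h3⟩
      · exact absurd (hF i (.inl h)) hv
      · exact absurd (hF i (.inr (.inl h))) hv
      · exact absurd (hF i (.inr (.inr h))) hv
      · exact ⟨_, ⟨_, hF _ h1, _, hF _ h2, fun h => h3 (e.symm.injective h),
          (hadj _ _).2 ((hnbr _ _).2 (.inl rfl)), (hadj _ _).2 ((hnbr _ _).2 (.inr rfl))⟩,
          .refl _⟩)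
  exact ⟨q, β', hβ.trans h1, h2⟩

end Cycles

/-! ### The main result -/

section Main

variable {V : Type*} [Fintype V] {G : SimpleGraph V} [DecidableRel G.Adj]

/-- With `Δ + 1` colours one colour can be removed. -/
lemma exists_reachIn_of_not_isFrozen (hG : G.Connected) {Δ : ℕ} (hΔ : ∀ v, G.degree v ≤ Δ)
    {α : G.Coloring (Fin (Δ + 1))} (hα : ¬ IsFrozen α)
    (hodd : ¬ (Odd (Fintype.card V) ∧
      Nonempty (G ≃g SimpleGraph.cycleGraph (Fintype.card V))))
    (hlong : ¬ (Δ + 1 = 3 ∧ 8 ≤ Fintype.card V ∧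
      Nonempty (G ≃g SimpleGraph.cycleGraph (Fintype.card V)))) :
    ∃ (q : _) (β : _), ReachIn (Fintype.card V + 2 * Fintype.card V ^ 2) α β ∧ ∀ u, β u ≠ q := by
  have hn : 0 < Fintype.card V := Fintype.card_pos_iff.2 hG.nonempty
  have hdeg : ∀ v, G.degree v + 1 ≤ Δ + 1 := fun v => Nat.succ_le_succ (hΔ v)
  by_cases hx : ∃ x, G.degree x < Δ
  · obtain ⟨x, hx⟩ := hx
    obtain ⟨β, h1, h2⟩ := exists_reachIn_of_degree_lt hG hdeg (x := x) (by omega) α 0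
    exact ⟨0, β, h1.mono (by omega), h2⟩
  push Not at hx
  have hreg : ∀ v, G.degree v = Δ := fun v => le_antisymm (hΔ v) (hx v)
  have h2 : 2 ≤ Δ := by
    obtain ⟨v, hv⟩ := exists_isFree_of_not_isFrozen hα
    obtain ⟨a, b, ha, hb, hab, -⟩ := exists_eq_of_isFree (by rw [hreg]) hv
    rw [← hreg v, ← SimpleGraph.card_neighborFinset_eq_degree]
    exact Finset.one_lt_card.2 ⟨a, by simpa using ha, b, by simpa using hb, hab⟩
  rcases h2.eq_or_lt with rfl | h3
  · obtain ⟨h3, ⟨e⟩⟩ := nonempty_iso_cycleGraph hG hreg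
    have hlt : Fintype.card V < 8 := by
      by_contra h
      exact hlong ⟨rfl, by omega, ⟨e⟩⟩
    have heven : Even (Fintype.card V) := by
      by_contra h
      exact hodd ⟨Nat.not_even_iff_odd.1 h, ⟨e⟩⟩
    have h46 : Fintype.card V = 4 ∨ Fintype.card V = 6 := by
      obtain ⟨m, hm⟩ := heven
      omega
    rcases h46 with h | h
    · rw [h] at e
      obtain ⟨q, β, t1, t2⟩ := exists_reachIn_of_iso_cycleGraph_four e hdeg α
      exact ⟨q, β, t1.mono (by omega), t2⟩
    · rw [h] at e
      obtain ⟨q, β, t1, t2⟩ := exists_reachIn_of_iso_cycleGraph_six e hreg hα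
      exact ⟨q, β, t1.mono (by omega), t2⟩
  · exact exists_reachIn_of_regular hG h3 hreg hα

/-- Brooks' theorem. -/
lemma nonempty_coloring_of_degree_le (hG : G.Connected) {Δ : ℕ} (hΔ : ∀ v, G.degree v ≤ Δ)
    (hcomplete : ¬ Nonempty (G ≃g SimpleGraph.completeGraph (Fin (Δ + 1))))
    (hodd : ¬ (Odd (Fintype.card V) ∧
      Nonempty (G ≃g SimpleGraph.cycleGraph (Fintype.card V)))) :
    Nonempty (G.Coloring (Fin Δ)) := by
  have hdeg : ∀ v, G.degree v + 1 ≤ Δ + 1 := fun v => Nat.succ_le_succ (hΔ v)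
  by_cases hx : ∃ x, G.degree x < Δ
  · obtain ⟨x, hx⟩ := hx
    obtain ⟨α, -⟩ := exists_coloring_eq hdeg (G.irrefl (v := x))
    obtain ⟨β, h1, h2⟩ := exists_reachIn_of_degree_lt hG hdeg (x := x) (by omega) α 0
    obtain ⟨γ, -⟩ := exists_widen_of_forall_ne h1 h2
    exact ⟨γ⟩
  push Not at hx
  have hreg : ∀ v, G.degree v = Δ := fun v => le_antisymm (hΔ v) (hx v)
  obtain ⟨v, a, b, ha, hb, hab, hnadj⟩ : ∃ v a b, G.Adj v a ∧ G.Adj v b ∧ a ≠ b ∧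
      ¬ G.Adj a b := by
    by_contra! h
    exact hcomplete (nonempty_iso_completeGraph hG hreg h)
  have h2 : 2 ≤ Δ := by
    rw [← hreg v, ← SimpleGraph.card_neighborFinset_eq_degree]
    exact Finset.one_lt_card.2 ⟨a, by simpa using ha, b, by simpa using hb, hab⟩
  rcases h2.eq_or_lt with rfl | h3
  · obtain ⟨-, ⟨e⟩⟩ := nonempty_iso_cycleGraph hG hreg
    have heven : Even (Fintype.card V) := by
      by_contra h
      exact hodd ⟨Nat.not_even_iff_odd.1 h, ⟨e⟩⟩
    exact ⟨G.recolorOfEquiv finTwoEquiv.symm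
      ((SimpleGraph.cycleGraph.bicoloring_of_even _ heven).comp e.toHom)⟩
  · obtain ⟨α, he⟩ := exists_coloring_eq hdeg hnadj
    obtain ⟨q, β, h1, h2⟩ :=
      exists_reachIn_of_regular hG h3 hreg (not_isFrozen_of_eq hdeg ha hb hab he)
    obtain ⟨γ, -⟩ := exists_widen_of_forall_ne h1 h2
    exact ⟨γ⟩

end Main

theorem theorem1 :
    ∃ C : ℕ, ∀ (V : Type*) [Fintype V] (G : SimpleGraph V) [DecidableRel G.Adj] (Δ k : ℕ)
      (hk : Δ + 1 ≤ k) (α : G.Coloring (Fin k)),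
      G.Connected → G.maxDegree = Δ → 1 ≤ Δ →
      ¬ IsFrozen α →
      -- `G` is not the complete graph on `Δ + 1` vertices
      ¬ Nonempty (G ≃g SimpleGraph.completeGraph (Fin (Δ + 1))) →
      -- `G` is not an odd cycle
      ¬ (Odd (Fintype.card V) ∧ Nonempty (G ≃g SimpleGraph.cycleGraph (Fintype.card V))) →
      -- if only three colours are available, `G` is not a cycle on eight or more vertices
      ¬ (k = 3 ∧ 8 ≤ Fintype.card V ∧
          Nonempty (G ≃g SimpleGraph.cycleGraph (Fintype.card V))) →
      ∃ γ : G.Coloring (Fin Δ),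
        (reconfGraph G k).Reachable α (widenColoring (Nat.le_of_succ_le hk) γ) ∧
        (reconfGraph G k).dist α (widenColoring (Nat.le_of_succ_le hk) γ) ≤
          C * Fintype.card V ^ 2 := by
  refine ⟨4, fun V _ G _ Δ k hk α hG hmax _ hα hcomplete hodd hlong => ?_⟩
  have hΔ : ∀ v, G.degree v ≤ Δ := fun v => hmax ▸ G.degree_le_maxDegree v
  suffices H : ∃ γ : G.Coloring (Fin Δ), ReachIn (4 * Fintype.card V ^ 2) α
      (widenColoring (Nat.le_of_succ_le hk) γ) by
    obtain ⟨γ, w, hw⟩ := H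
    exact ⟨γ, w.reachable, (SimpleGraph.dist_le w).trans hw⟩
  rcases hk.eq_or_lt with rfl | hk'
  · obtain ⟨q, β, h1, h2⟩ := exists_reachIn_of_not_isFrozen hG hΔ hα hodd hlong
    obtain ⟨γ, hγ⟩ := exists_widen_of_forall_ne h1 h2
    refine ⟨γ, hγ.mono ?_⟩
    have := Nat.le_self_pow two_ne_zero (Fintype.card V)
    omega
  · obtain ⟨γ⟩ := nonempty_coloring_of_degree_le hG hΔ hcomplete hodd
    refine ⟨γ, (exists_reachIn_of_degree_add_two_le hΔ hk' α _).mono ?_⟩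
    have : Nonempty V := hG.nonempty
    have hlt : Δ + 1 ≤ Fintype.card V := hmax ▸ G.maxDegree_lt_card_verts
    calc Fintype.card V * (Δ + 1) ≤ Fintype.card V * Fintype.card V := Nat.mul_le_mul_left _ hlt
      _ ≤ 4 * Fintype.card V ^ 2 := by rw [sq]; omega
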